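/- Let the pseudo-factorials $(\alpha_n)_{n\ge0}$ be the integers defined by $\alpha_0=1$ and $\alpha_{n+1}=(-1)^{n+1}\sum_{k=0}^{n}\binom{n}{k}\alpha_k\alpha_{n-k}$, and let $f(w)=\sum_{n\ge0}\alpha_n w^n/n!$ be their exponential generating function. The series converges for $|w|<1$ and $f$ extends to a meromorphic function on $\mathbb{C}$, again denoted by $f$. Let $\wp(z)=\wp(z;0,-4)$ be the Weierstrass function with invariants $g_2=0$ and $g_3=-4$ (it exists; it satisfies $\wp'^2=4\wp^3+4$ and $\wp(z)\sim z^{-2}$ as $z\to0$). Then the smallest positive real period $6r$ of $\wp$ is $$6r=\pi_3\,2^{-1/3}=\frac{2^{-4/3}\,3^{1/2}}{\pi}\,\Gamma\!\left(\tfrac13\right)^3,\qquad \pi_3:=3\int_0^1\frac{dy}{(1-y^3)^{2/3}},$$ and $$f(i\sqrt3\,z)=\frac{-\wp'(z+3r)-2i\sqrt3}{2i\sqrt3\,\wp(z+3r)}$$ for every $z\in\mathbb{C}$ for which $z+3r$ is neither a pole nor a zero of $\wp$. -/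

import Mathlib

/-- The pseudo-factorials: `α 0 = 1` and
`α (n+1) = (-1)^(n+1) * ∑_{k=0}^n (n choose k) * α k * α (n-k)`. -/
def pseudoFactorial : ℕ → ℤ
  | 0 => 1
  | n + 1 => (-1) ^ (n + 1) *
      ∑ k : Fin (n + 1), (n.choose k : ℤ) * pseudoFactorial k * pseudoFactorial (n - k)
  termination_by n => n
  decreasing_by
    · exact k.isLt
    · omega

/-- The recurrence, with the sum written over `{0, …, n}`. -/
theorem pseudoFactorial_succ (n : ℕ) :
    pseudoFactorial (n + 1) = (-1) ^ (n + 1) *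
      ∑ k ∈ Finset.range (n + 1),
        (n.choose k : ℤ) * pseudoFactorial k * pseudoFactorial (n - k) := by
  rw [pseudoFactorial, Finset.sum_range]

/-- `f` is the exponential generating function `∑ αₙ wⁿ / n!` of the pseudo-factorials, as a
meromorphic function on the complex plane: the series converges to `f` on the unit disc and `f` is
its meromorphic continuation (in normal form: `f` takes its correct value at every point that is
not a pole, and the value `0` at poles, so that `f` is unique). -/
def IsPseudoFactorialEGF (f : ℂ → ℂ) : Prop :=
  MeromorphicNFOn f Set.univ ∧
    ∀ w : ℂ, ‖w‖ < 1 →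
      HasSum (fun n : ℕ => (pseudoFactorial n : ℂ) * w ^ n / (n.factorial : ℂ)) (f w)

/-- The constant `π₃ = 3 ∫₀¹ (1 - y³)^(-2/3) dy`. -/
noncomputable def piThree : ℝ :=
  3 * ∫ y in (0 : ℝ)..1, 1 / (1 - y ^ 3) ^ (2 / 3 : ℝ)

/-!
The recurrence says that `f` solves `f'(w) = -f(-w)²`, `f(0) = 1`, and these determine its Taylor
coefficients. For `κ² = -3` and `g₂ = 0`, `g₃ = -4`, the elliptic function
`F = (-℘' - 2κ) / (2κ℘)` satisfies `F'(z) = -κ F(-z)²` by the differential equation of `℘`. At a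
half-period `a` with `℘(a) = -1` it takes the value `1`, so `w ↦ F(w / κ + a)` has the Taylor
coefficients of `f`, because `-w / κ + a ≡ -(w / κ + a)` modulo the lattice.

Since `g₂` and `g₃` determine the lattice, it is stable under complex conjugation and under
multiplication by `exp(2πi/3)`. The first symmetry makes `℘` real on the real axis. By the second,
three times a zero of `℘` is a lattice point, which places the real zeros of `℘` at the thirds of
the real period `T`. On the middle third `℘'` increases from `-2` to `2` with
`℘'' = 6℘² = 6((℘'² - 4)/4)^(2/3)`, and `u = (2 + ℘')/4` turns its length into a multiple of the
beta integral `B(1/3, 1/3)`.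
-/

open Filter Topology Set
open scoped PeriodPair ComplexConjugate

namespace PseudoFactorial

section Meromorphic

variable {𝕜 E : Type*} [NontriviallyNormedField 𝕜] [NormedAddCommGroup E] [NormedSpace 𝕜 E]
  {f g : 𝕜 → E} {U : Set 𝕜} {x y : 𝕜}

theorem eventuallyEq_nhdsNE_of_isPreconnected [CompleteSpace 𝕜] (hf : MeromorphicOn f U)
    (hg : MeromorphicOn g U) (hU : IsPreconnected U) (hx : x ∈ U) (hy : y ∈ U)
    (h : f =ᶠ[𝓝[≠] x] g) : f =ᶠ[𝓝[≠] y] g := by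
  rw [eventuallyEq_iff_sub] at h ⊢
  refine meromorphicOrderAt_eq_top_iff.1 ?_
  by_contra hne
  exact (hf.sub hg).meromorphicOrderAt_ne_top_of_isPreconnected hU hy hx hne
    (meromorphicOrderAt_eq_top_iff.2 h)

theorem eq_of_eventuallyEq_nhdsNE (hf : MeromorphicNFAt f x) (hg : MeromorphicNFAt g x)
    (h : f =ᶠ[𝓝[≠] x] g) : f x = g x :=
  ((hf.eventuallyEq_nhdsNE_iff_eventuallyEq_nhds hg).1 h).eq_of_nhds

theorem tendsto_sub_mul_logDeriv {f : 𝕜 → 𝕜} [CompleteSpace 𝕜] (hf : MeromorphicAt f x) {n : ℤ}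
    (hn : meromorphicOrderAt f x = n) :
    Tendsto (fun z => (z - x) * logDeriv f z) (𝓝[≠] x) (𝓝 n) := by
  obtain ⟨g, hg, hgx, hfg⟩ := (meromorphicOrderAt_eq_int_iff hf).1 hn
  have hlog : (fun z => n + (z - x) * logDeriv g z) =ᶠ[𝓝[≠] x]
      fun z => (z - x) * logDeriv f z := by
    filter_upwards [logDeriv_congr_nhdsNE hfg, self_mem_nhdsWithin,
      hg.eventually_analyticAt.filter_mono nhdsWithin_le_nhds,
      (hg.continuousAt.eventually_ne hgx).filter_mono nhdsWithin_le_nhds] with z hz hzx hgz hgz0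
    have hzx : z - x ≠ 0 := sub_ne_zero.2 hzx
    have hd : DifferentiableAt 𝕜 (fun z => z - x) z := by fun_prop
    simp only [hz, smul_eq_mul]
    rw [logDeriv_mul (f := fun z => (z - x) ^ n) z (zpow_ne_zero n hzx) hgz0
      (hd.zpow (.inl hzx)) hgz.differentiableAt, logDeriv_fun_zpow hd]
    simp only [logDeriv_apply, deriv_sub_const, deriv_id'']
    field_simp
  have hcont : ContinuousAt (fun z => n + (z - x) * logDeriv g z) x := by
    have := hg.continuousAt
    have := hg.deriv.continuousAt
    simp only [logDeriv_apply]
    fun_prop (disch := assumption)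
  simpa using (hcont.tendsto.mono_left nhdsWithin_le_nhds).congr' hlog

end Meromorphic

section LinearODE

variable {𝕜 : Type*} [NontriviallyNormedField 𝕜] [CompleteSpace 𝕜] {D : 𝕜 → 𝕜} {x : 𝕜}

theorem eventually_eq_zero_of_deriv_deriv_eq_mul [CharZero 𝕜] {H : 𝕜 → 𝕜} (hD : AnalyticAt 𝕜 D x)
    (hH : AnalyticAt 𝕜 H x) (h0 : D x = 0) (h1 : deriv D x = 0)
    (h : ∀ᶠ z in 𝓝 x, deriv (deriv D) z = H z * D z) : ∀ᶠ z in 𝓝 x, D z = 0 := by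
  have hD' := hD.analyticOrderAt_deriv_add_one
  have hD'' := hD.deriv.analyticOrderAt_deriv_add_one
  have hHD : analyticOrderAt (deriv (deriv D)) x = analyticOrderAt H x + analyticOrderAt D x :=
    (analyticOrderAt_congr h).trans (analyticOrderAt_mul hH hD)
  simp only [h0, h1, sub_zero] at hD' hD''
  rw [← analyticOrderAt_eq_top]
  rw [← hD', ← hD''] at hHD ⊢
  generalize analyticOrderAt (deriv (deriv D)) x = n at hHD ⊢
  by_contra hne
  lift n to ℕ using by simpa using hne
  have hle : (n : ℕ∞) + 1 + 1 ≤ n := le_add_self.trans_eq hHD.symm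
  norm_cast at hle
  lia

theorem eventuallyEq_of_deriv_deriv_eq_mul_sq_add [CharZero 𝕜] {u v : 𝕜 → 𝕜} {a c : 𝕜}
    (hu : AnalyticAt 𝕜 u x) (hv : AnalyticAt 𝕜 v x) (h0 : u x = v x) (h1 : deriv u x = deriv v x)
    (hu2 : ∀ᶠ z in 𝓝 x, deriv (deriv u) z = a * u z ^ 2 + c)
    (hv2 : ∀ᶠ z in 𝓝 x, deriv (deriv v) z = a * v z ^ 2 + c) : u =ᶠ[𝓝 x] v := by
  have hderiv : deriv (u - v) =ᶠ[𝓝 x] deriv u - deriv v := by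
    filter_upwards [hu.eventually_analyticAt, hv.eventually_analyticAt] with z hz hz'
    exact deriv_sub hz.differentiableAt hz'.differentiableAt
  rw [eventuallyEq_iff_sub]
  refine eventually_eq_zero_of_deriv_deriv_eq_mul (H := fun z => a * (u z + v z)) (hu.sub hv)
    (by fun_prop) (sub_eq_zero.2 h0) (by simp [hderiv.eq_of_nhds, h1]) ?_
  filter_upwards [hderiv.eventually_nhds, hu2, hv2, hu.deriv.eventually_analyticAt,
    hv.deriv.eventually_analyticAt] with z hz hzu hzv hu' hv'
  rw [EventuallyEq.deriv_eq hz, deriv_sub hu'.differentiableAt hv'.differentiableAt, hzu, hzv,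
    Pi.sub_apply]
  ring

/-- At a regular singular point a nonzero solution of `(z - x) A D' = K D` has an order `n`, and
`(z - x) D' / D → n` turns the equation into the indicial equation `n A(x) = K(x)`. -/
theorem eventually_eq_zero_of_natCast_mul_ne {A K : 𝕜 → 𝕜} (hD : AnalyticAt 𝕜 D x)
    (hA : ContinuousAt A x) (hK : ContinuousAt K x)
    (h : ∀ᶠ z in 𝓝[≠] x, (z - x) * A z * deriv D z = K z * D z) (hn : ∀ n : ℕ, n * A x ≠ K x) :
    ∀ᶠ z in 𝓝 x, D z = 0 := by
  rw [← analyticOrderAt_eq_top]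
  by_contra hne
  obtain ⟨n, hDn⟩ := ENat.ne_top_iff_exists.1 hne
  have hord : meromorphicOrderAt D x = ((n : ℤ) : WithTop ℤ) := by
    rw [hD.meromorphicOrderAt_eq, ← hDn]
    rfl
  have hD0 : ∀ᶠ z in 𝓝[≠] x, D z ≠ 0 :=
    hD.eventually_eq_zero_or_eventually_ne_zero.resolve_left
      fun h0 => hne (analyticOrderAt_eq_top.2 h0)
  have hlim := (tendsto_sub_mul_logDeriv hD.meromorphicAt hord).mul
    (hA.tendsto.mono_left nhdsWithin_le_nhds)
  rw [Int.cast_natCast] at hlim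
  refine hn n (tendsto_nhds_unique (hlim.congr' ?_)
    (hK.tendsto.mono_left nhdsWithin_le_nhds))
  filter_upwards [h, hD0] with z hz hz0
  rw [logDeriv_apply]
  field_simp
  linear_combination hz

end LinearODE

section WeierstrassP

variable (L : PeriodPair)

theorem mem_lattice_iff_meromorphicOrderAt_neg {z : ℂ} :
    z ∈ L.lattice ↔ meromorphicOrderAt ℘[L] z < 0 := by
  refine ⟨fun hz => ?_, fun hz => ?_⟩
  · rw [L.order_weierstrassP z hz]
    decide
  · by_contra hmem
    exact hz.not_ge (L.analyticOnNhd_weierstrassP z hmem).meromorphicOrderAt_nonneg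

theorem meromorphic_weierstrassP_comp_add (a : ℂ) : Meromorphic fun z => ℘[L] (z + a) := fun z =>
  (L.meromorphic_weierstrassP (z + a)).comp_analyticAt (g := fun z => z + a) (by fun_prop)

theorem mem_lattice_iff_of_eventuallyEq {L M : PeriodPair} {a b x : ℂ}
    (h : (fun z => ℘[L] (z + a)) =ᶠ[𝓝[≠] x] fun z => ℘[M] (z + b)) (y : ℂ) :
    y + a ∈ L.lattice ↔ y + b ∈ M.lattice := by
  have hy : (fun z => ℘[L] (z + a)) =ᶠ[𝓝[≠] y] fun z => ℘[M] (z + b) :=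
    eventuallyEq_nhdsNE_of_isPreconnected (fun z _ => meromorphic_weierstrassP_comp_add L a z)
      (fun z _ => meromorphic_weierstrassP_comp_add M b z) isPreconnected_univ (mem_univ x)
      (mem_univ y) h
  simp only [mem_lattice_iff_meromorphicOrderAt_neg,
    ← meromorphicOrderAt_comp_add_const_eq_meromorphicOrderAt (f := ℘[L]),
    ← meromorphicOrderAt_comp_add_const_eq_meromorphicOrderAt (f := ℘[M])]
  exact iff_of_eq (congrArg (· < 0) (meromorphicOrderAt_congr hy))

theorem periodic_weierstrassP_iff {c : ℂ} : Function.Periodic ℘[L] c ↔ c ∈ L.lattice := by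
  refine ⟨fun h => ?_, fun h => L.periodic_weierstrassP ⟨c, h⟩⟩
  have h0 : (fun z => ℘[L] (z + c)) =ᶠ[𝓝[≠] 0] fun z => ℘[L] (z + 0) :=
    .of_forall fun z => by simp only [h z, add_zero]
  simpa using mem_lattice_iff_of_eventuallyEq h0 0

theorem weierstrassP_eq_weierstrassPExcept_add (z : ℂ) :
    ℘[L] z = L.weierstrassPExcept 0 z + 1 / z ^ 2 := by
  simpa using (L.weierstrassPExcept_add 0 z).symm

theorem derivWeierstrassP_eq_derivWeierstrassPExcept_sub (z : ℂ) :
    ℘'[L] z = L.derivWeierstrassPExcept 0 z - 2 / z ^ 3 := by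
  simpa using (L.derivWeierstrassPExcept_sub 0 z).symm

theorem hasDerivAt_weierstrassPExcept_zero :
    ∀ᶠ z in 𝓝 0, HasDerivAt (L.weierstrassPExcept 0) (L.derivWeierstrassPExcept 0 z) z := by
  filter_upwards [L.compl_lattice_sdiff_singleton_mem_nhds 0,
    (L.analyticAt_weierstrassPExcept 0).eventually_analyticAt] with z hz hanalytic
  rw [← L.eqOn_deriv_weierstrassPExcept_derivWeierstrassPExcept 0 hz]
  exact hanalytic.differentiableAt.hasDerivAt

theorem eventually_notMem_lattice_nhdsNE (x : ℂ) : ∀ᶠ z in 𝓝[≠] x, z ∉ L.lattice := by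
  filter_upwards [nhdsWithin_le_nhds (L.compl_lattice_sdiff_singleton_mem_nhds x),
    self_mem_nhdsWithin] with z hz hzx hzL
  exact hz ⟨hzL, hzx⟩

variable {L}

theorem eventually_notMem_lattice {z : ℂ} (hz : z ∉ L.lattice) : ∀ᶠ w in 𝓝 z, w ∉ L.lattice :=
  L.isClosed_lattice.isOpen_compl.mem_nhds hz

theorem hasDerivAt_weierstrassP {z : ℂ} (hz : z ∉ L.lattice) : HasDerivAt ℘[L] (℘'[L] z) z := by
  rw [← L.deriv_weierstrassP]
  exact (L.analyticOnNhd_weierstrassP z hz).differentiableAt.hasDerivAt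

theorem eventually_derivWeierstrassP_ne_zero (z : ℂ) : ∀ᶠ w in 𝓝[≠] z, ℘'[L] w ≠ 0 := by
  have hzero : meromorphicOrderAt ℘'[L] 0 ≠ ⊤ := by
    rw [← L.deriv_weierstrassP, meromorphicOrderAt_deriv_eq_sub_one (n := -2) (by norm_num)
      (L.order_weierstrassP 0 (zero_mem _))]
    exact WithTop.coe_ne_top
  have hmer : MeromorphicOn ℘'[L] univ := fun w _ => L.meromorphic_derivWeierstrassP w
  exact (meromorphicOrderAt_ne_top_iff_eventually_ne_zero (hmer z (mem_univ z))).1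
    (hmer.meromorphicOrderAt_ne_top_of_isPreconnected isPreconnected_univ (mem_univ 0)
      (mem_univ z) hzero)

theorem derivWeierstrassP_mul_deriv_derivWeierstrassP {z : ℂ} (hz : z ∉ L.lattice) :
    ℘'[L] z * deriv ℘'[L] z = ℘'[L] z * (6 * ℘[L] z ^ 2 - L.g₂ / 2) := by
  have hP := hasDerivAt_weierstrassP hz
  have hP' := (L.analyticOnNhd_derivWeierstrassP z hz).differentiableAt.hasDerivAt
  have hsq : (fun w => ℘'[L] w ^ 2) =ᶠ[𝓝 z] fun w => 4 * ℘[L] w ^ 3 - L.g₂ * ℘[L] w - L.g₃ :=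
    (eventually_notMem_lattice hz).mono L.derivWeierstrassP_sq
  have hderiv := hsq.deriv_eq
  rw [(hP'.fun_pow 2).deriv,
    ((((hP.fun_pow 3).const_mul 4).fun_sub (hP.const_mul L.g₂)).sub_const L.g₃).deriv] at hderiv
  norm_num only at hderiv
  linear_combination hderiv / 2

theorem hasDerivAt_derivWeierstrassP {z : ℂ} (hz : z ∉ L.lattice) :
    HasDerivAt ℘'[L] (6 * ℘[L] z ^ 2 - L.g₂ / 2) z := by
  have hP := L.analyticOnNhd_weierstrassP z hz
  have hP' := L.analyticOnNhd_derivWeierstrassP z hz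
  have heq : deriv ℘'[L] =ᶠ[𝓝[≠] z] fun w => 6 * ℘[L] w ^ 2 - L.g₂ / 2 := by
    filter_upwards [eventually_derivWeierstrassP_ne_zero z,
      (eventually_notMem_lattice hz).filter_mono nhdsWithin_le_nhds] with w hw hwL
    exact mul_left_cancel₀ hw (derivWeierstrassP_mul_deriv_derivWeierstrassP hwL)
  have hRHS : AnalyticAt ℂ (fun w => 6 * ℘[L] w ^ 2 - L.g₂ / 2) z := by fun_prop
  rw [← eq_of_eventuallyEq_nhdsNE hP'.deriv.meromorphicNFAt hRHS.meromorphicNFAt heq]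
  exact hP'.differentiableAt.hasDerivAt

theorem derivWeierstrassP_half_period {l : ℂ} (hl : l ∈ L.lattice) : ℘'[L] (l / 2) = 0 := by
  have h := L.derivWeierstrassP_add_coe (-(l / 2)) ⟨l, hl⟩
  rw [show -(l / 2) + l = l / 2 by ring, L.derivWeierstrassP_neg] at h
  exact CharZero.eq_neg_self_iff.1 h

end WeierstrassP

section Invariants

/-- The difference of the equations `℘'² = 4℘³ - g₂℘ - g₃` of two lattices, cleared of poles. -/
theorem mul_sub_derivWeierstrassPExcept {L M : PeriodPair} (h2 : L.g₂ = M.g₂) (h3 : L.g₃ = M.g₃)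
    {z : ℂ} (hL : z ∉ L.lattice) (hM : z ∉ M.lattice) :
    z * (z ^ 3 * (L.derivWeierstrassPExcept 0 z + M.derivWeierstrassPExcept 0 z) - 4) *
        (L.derivWeierstrassPExcept 0 z - M.derivWeierstrassPExcept 0 z) =
      (4 * ((z ^ 2 * L.weierstrassPExcept 0 z + 1) ^ 2 +
        (z ^ 2 * L.weierstrassPExcept 0 z + 1) * (z ^ 2 * M.weierstrassPExcept 0 z + 1) +
        (z ^ 2 * M.weierstrassPExcept 0 z + 1) ^ 2) - M.g₂ * z ^ 4) *
      (L.weierstrassPExcept 0 z - M.weierstrassPExcept 0 z) := by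
  have hz : z ≠ 0 := fun h => hL (h ▸ zero_mem _)
  have eqL := L.derivWeierstrassP_sq z hL
  have eqM := M.derivWeierstrassP_sq z hM
  rw [weierstrassP_eq_weierstrassPExcept_add,
    derivWeierstrassP_eq_derivWeierstrassPExcept_sub] at eqL eqM
  rw [h2, h3] at eqL
  field_simp at eqL eqM
  refine mul_left_cancel₀ (pow_ne_zero 2 hz) ?_
  linear_combination eqL - eqM

theorem lattice_eq_of_invariants {L M : PeriodPair} (h2 : L.g₂ = M.g₂) (h3 : L.g₃ = M.g₃) :
    L.lattice = M.lattice := by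
  have hPL := L.analyticAt_weierstrassPExcept 0
  have hPM := M.analyticAt_weierstrassPExcept 0
  have hPL' := (L.analyticAt_derivWeierstrassPExcept 0).continuousAt
  have hPM' := (M.analyticAt_derivWeierstrassPExcept 0).continuousAt
  have hcL := hPL.continuousAt
  have hcM := hPM.continuousAt
  have hregular : ∀ᶠ z in 𝓝 0, (L.weierstrassPExcept 0 - M.weierstrassPExcept 0) z = 0 := by
    refine eventually_eq_zero_of_natCast_mul_ne
      (A := fun z => z ^ 3 * (L.derivWeierstrassPExcept 0 z + M.derivWeierstrassPExcept 0 z) - 4)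
      (K := fun z => 4 * ((z ^ 2 * L.weierstrassPExcept 0 z + 1) ^ 2 +
        (z ^ 2 * L.weierstrassPExcept 0 z + 1) * (z ^ 2 * M.weierstrassPExcept 0 z + 1) +
        (z ^ 2 * M.weierstrassPExcept 0 z + 1) ^ 2) - M.g₂ * z ^ 4)
      (hPL.sub hPM) (by fun_prop) (by fun_prop) ?_ ?_
    · filter_upwards [eventually_notMem_lattice_nhdsNE L 0, eventually_notMem_lattice_nhdsNE M 0,
        (hasDerivAt_weierstrassPExcept_zero L).filter_mono nhdsWithin_le_nhds,
        (hasDerivAt_weierstrassPExcept_zero M).filter_mono nhdsWithin_le_nhds] with z hL hM dL dM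
      rw [(dL.sub dM).deriv, sub_zero]
      exact mul_sub_derivWeierstrassPExcept h2 h3 hL hM
    · intro n hn
      norm_num only at hn
      have : (n : ℂ) + 3 = 0 := by linear_combination -hn / 4
      norm_cast at this
  have h : (fun z => ℘[L] (z + 0)) =ᶠ[𝓝[≠] 0] fun z => ℘[M] (z + 0) := by
    filter_upwards [hregular.filter_mono nhdsWithin_le_nhds] with z hz
    rw [add_zero, weierstrassP_eq_weierstrassPExcept_add, weierstrassP_eq_weierstrassPExcept_add,
      sub_eq_zero.1 hz]
  ext y
  simpa only [add_zero] using mem_lattice_iff_of_eventuallyEq h y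

variable {L : PeriodPair}

theorem sub_mem_lattice_of_eq {a b : ℂ} (ha : a ∉ L.lattice) (hb : b ∉ L.lattice)
    (h : ℘[L] a = ℘[L] b) (h' : ℘'[L] a = ℘'[L] b) : a - b ∈ L.lattice := by
  have hanalytic {c : ℂ} (hc : c ∉ L.lattice) : AnalyticAt ℂ (fun z => ℘[L] (z + c)) 0 :=
    (L.analyticOnNhd_weierstrassP c hc).comp_of_eq (g := ℘[L]) (by fun_prop) (zero_add c)
  have hderiv (c : ℂ) : deriv (fun z => ℘[L] (z + c)) = fun z => ℘'[L] (z + c) := by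
    funext z
    rw [deriv_comp_add_const, L.deriv_weierstrassP]
  have hderiv2 {c : ℂ} (hc : c ∉ L.lattice) : ∀ᶠ z in 𝓝 0,
      deriv (deriv fun z => ℘[L] (z + c)) z = 6 * ℘[L] (z + c) ^ 2 + -(L.g₂ / 2) := by
    have hadd : Tendsto (fun z => z + c) (𝓝 0) (𝓝 c) :=
      (continuous_add_const c).tendsto' 0 c (zero_add c)
    filter_upwards [hadd.eventually (eventually_notMem_lattice hc)] with z hz
    rw [hderiv, deriv_comp_add_const, (hasDerivAt_derivWeierstrassP hz).deriv, sub_eq_add_neg]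
  have heq : (fun z => ℘[L] (z + a)) =ᶠ[𝓝 0] fun z => ℘[L] (z + b) :=
    eventuallyEq_of_deriv_deriv_eq_mul_sq_add (hanalytic ha) (hanalytic hb)
      (by simpa only [zero_add] using h) (by simpa only [hderiv, zero_add] using h')
      (hderiv2 ha) (hderiv2 hb)
  rw [sub_eq_neg_add]
  refine (mem_lattice_iff_of_eventuallyEq (heq.filter_mono nhdsWithin_le_nhds) (-b)).2 ?_
  rw [neg_add_cancel]
  exact zero_mem _

theorem sub_mem_or_add_mem_lattice_of_eq {a b : ℂ} (ha : a ∉ L.lattice) (hb : b ∉ L.lattice)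
    (h : ℘[L] a = ℘[L] b) : a - b ∈ L.lattice ∨ a + b ∈ L.lattice := by
  have hsq : ℘'[L] a ^ 2 = ℘'[L] b ^ 2 := by
    rw [L.derivWeierstrassP_sq a ha, L.derivWeierstrassP_sq b hb, h]
  refine (sq_eq_sq_iff_eq_or_eq_neg.1 hsq).imp (sub_mem_lattice_of_eq ha hb h) fun h' => ?_
  rw [← sub_neg_eq_add]
  exact sub_mem_lattice_of_eq ha (by rwa [neg_mem_iff]) (by rw [L.weierstrassP_neg, h])
    (by rw [L.derivWeierstrassP_neg, h'])

theorem omega_sub_div_two_notMem_lattice (L : PeriodPair) : L.ω₁ / 2 - L.ω₂ / 2 ∉ L.lattice := by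
  have h := L.mul_ω₁_add_mul_ω₂_mem_lattice (α := 1 / 2) (β := -1 / 2)
  rw [show ((1 / 2 : ℚ) : ℂ) * L.ω₁ + ((-1 / 2 : ℚ) : ℂ) * L.ω₂ = L.ω₁ / 2 - L.ω₂ / 2 by
    push_cast; ring] at h
  rw [h]
  norm_num

/-- With `g₂ = g₃ = 0` the equation `℘'² = 4℘³` makes `℘` and `℘'` both vanish at all the
half-periods, which would then be congruent. -/
theorem g₃_ne_zero_of_g₂_eq_zero (h2 : L.g₂ = 0) : L.g₃ ≠ 0 := by
  intro h3
  have hzero {l : ℂ} (hl : l ∈ L.lattice) (hl2 : l / 2 ∉ L.lattice) : ℘[L] (l / 2) = 0 := by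
    have h := L.derivWeierstrassP_sq _ hl2
    simpa [h2, h3, derivWeierstrassP_half_period hl] using h
  refine omega_sub_div_two_notMem_lattice L (sub_mem_lattice_of_eq L.ω₁_div_two_notMem_lattice
    L.ω₂_div_two_notMem_lattice ?_ ?_)
  · rw [hzero L.ω₁_mem_lattice L.ω₁_div_two_notMem_lattice,
      hzero L.ω₂_mem_lattice L.ω₂_div_two_notMem_lattice]
  · rw [derivWeierstrassP_half_period L.ω₁_mem_lattice,
      derivWeierstrassP_half_period L.ω₂_mem_lattice]

end Invariants

section Transport

theorem weierstrassP_congr {L M : PeriodPair} (h : L.lattice = M.lattice) : ℘[L] = ℘[M] := by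
  funext z
  rw [PeriodPair.weierstrassP, PeriodPair.weierstrassP, h]

theorem derivWeierstrassP_congr {L M : PeriodPair} (h : L.lattice = M.lattice) :
    ℘'[L] = ℘'[M] := by
  rw [← L.deriv_weierstrassP, weierstrassP_congr h, M.deriv_weierstrassP]

theorem eisensteinG_congr {L M : PeriodPair} (h : L.lattice = M.lattice) : L.G = M.G := by
  funext n
  rw [PeriodPair.G, PeriodPair.G, h]

/-- The image of a period pair under a real-linear automorphism of the plane; its lattice is the
image of the lattice. It serves to move lattices by complex multiplications and by conjugation. -/
noncomputable def mapPair (L : PeriodPair) (σ : ℂ ≃ₗ[ℝ] ℂ) : PeriodPair where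
  ω₁ := σ L.ω₁
  ω₂ := σ L.ω₂
  indep := by
    have h : ![σ L.ω₁, σ L.ω₂] = σ ∘ ![L.ω₁, L.ω₂] := by
      ext i
      fin_cases i <;> rfl
    rw [h]
    exact L.indep.map' σ.toLinearMap σ.ker

/-- Multiplication by a nonzero complex number, as a real-linear automorphism of the plane. -/
noncomputable def mulEquiv {c : ℂ} (hc : c ≠ 0) : ℂ ≃ₗ[ℝ] ℂ :=
  (LinearEquiv.smulOfNeZero ℂ ℂ c hc).restrictScalars ℝ

@[simp]
theorem mulEquiv_apply {c : ℂ} (hc : c ≠ 0) (z : ℂ) : mulEquiv hc z = c * z := rfl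

variable {L : PeriodPair} {σ : ℂ ≃ₗ[ℝ] ℂ} {c : ℂ}

theorem apply_mem_lattice_mapPair {x : ℂ} : σ x ∈ (mapPair L σ).lattice ↔ x ∈ L.lattice := by
  have h (m n : ℤ) : σ (m * L.ω₁ + n * L.ω₂) = m * σ L.ω₁ + n * σ L.ω₂ := by
    simp only [← zsmul_eq_mul, map_add, map_zsmul]
  simp only [PeriodPair.mem_lattice, ← σ.injective.eq_iff (b := x), h]
  rfl

theorem tsum_lattice_mapPair (f : ℂ → ℂ) :
    ∑' l : (mapPair L σ).lattice, f l = ∑' l : L.lattice, f (σ l) :=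
  ((σ.toEquiv.subtypeEquiv fun _ => apply_mem_lattice_mapPair.symm).tsum_eq
    fun l : (mapPair L σ).lattice => f l).symm

theorem eisensteinG_mapPair_mulEquiv (hc : c ≠ 0) (n : ℕ) :
    (mapPair L (mulEquiv hc)).G n = (c ^ n)⁻¹ * L.G n := by
  rw [PeriodPair.G, tsum_lattice_mapPair fun l => (l ^ n)⁻¹, PeriodPair.G, ← tsum_mul_left]
  simp only [mulEquiv_apply, mul_pow, mul_inv]

theorem g₂_mapPair_mulEquiv (hc : c ≠ 0) : (mapPair L (mulEquiv hc)).g₂ = (c ^ 4)⁻¹ * L.g₂ := by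
  rw [PeriodPair.g₂, PeriodPair.g₂, eisensteinG_mapPair_mulEquiv]
  ring

theorem g₃_mapPair_mulEquiv (hc : c ≠ 0) : (mapPair L (mulEquiv hc)).g₃ = (c ^ 6)⁻¹ * L.g₃ := by
  rw [PeriodPair.g₃, PeriodPair.g₃, eisensteinG_mapPair_mulEquiv]
  ring

theorem weierstrassP_mapPair_mulEquiv (hc : c ≠ 0) (z : ℂ) :
    ℘[mapPair L (mulEquiv hc)] (c * z) = (c ^ 2)⁻¹ * ℘[L] z := by
  rw [PeriodPair.weierstrassP, tsum_lattice_mapPair fun l => 1 / (c * z - l) ^ 2 - 1 / l ^ 2,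
    PeriodPair.weierstrassP, ← tsum_mul_left]
  simp only [mulEquiv_apply, ← mul_sub, mul_pow, one_div, mul_inv]

theorem eisensteinG_mapPair_conj (n : ℕ) :
    (mapPair L Complex.conjAe.toLinearEquiv).G n = conj (L.G n) := by
  rw [PeriodPair.G, tsum_lattice_mapPair fun l => (l ^ n)⁻¹, PeriodPair.G, Complex.conj_tsum]
  simp

theorem weierstrassP_mapPair_conj (z : ℂ) :
    ℘[mapPair L Complex.conjAe.toLinearEquiv] (conj z) = conj (℘[L] z) := by
  rw [PeriodPair.weierstrassP, tsum_lattice_mapPair fun l => 1 / (conj z - l) ^ 2 - 1 / l ^ 2,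
    PeriodPair.weierstrassP, Complex.conj_tsum]
  simp

theorem derivWeierstrassP_mapPair_conj (z : ℂ) :
    ℘'[mapPair L Complex.conjAe.toLinearEquiv] (conj z) = conj (℘'[L] z) := by
  rw [PeriodPair.derivWeierstrassP, tsum_lattice_mapPair fun l => 2 / (conj z - l) ^ 3,
    PeriodPair.derivWeierstrassP, map_neg, Complex.conj_tsum]
  simp [Complex.conj_ofNat]

theorem lattice_mapPair_eq (h : ∀ x, σ x ∈ L.lattice ↔ x ∈ L.lattice) :
    (mapPair L σ).lattice = L.lattice := by
  ext x
  obtain ⟨y, rfl⟩ := σ.surjective x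
  rw [apply_mem_lattice_mapPair, h]

theorem apply_mem_lattice_iff_of_eq (h : (mapPair L σ).lattice = L.lattice) {x : ℂ} :
    σ x ∈ L.lattice ↔ x ∈ L.lattice := by
  rw [← apply_mem_lattice_mapPair (σ := σ) (x := x), h]

end Transport

section EquianharmonicLattice

variable {L : PeriodPair} {c ρ : ℂ}

theorem eisensteinG_eq_zero_of_mul_mem_lattice_iff (hc : c ≠ 0)
    (h : ∀ x, c * x ∈ L.lattice ↔ x ∈ L.lattice) {n : ℕ} (hn : c ^ n ≠ 1) : L.G n = 0 := by
  have hG := congrFun (eisensteinG_congr (lattice_mapPair_eq (σ := mulEquiv hc) h)) n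
  rw [eisensteinG_mapPair_mulEquiv, inv_mul_eq_iff_eq_mul₀ (pow_ne_zero n hc)] at hG
  refine (mul_eq_zero.1 ?_).resolve_left (sub_ne_zero.2 hn)
  linear_combination -hG

theorem one_add_add_sq_of_isPrimitiveRoot_three (hρ : IsPrimitiveRoot ρ 3) :
    1 + ρ + ρ ^ 2 = 0 := by
  simpa [Finset.sum_range_succ] using hρ.geom_sum_eq_zero (by norm_num)

/-- The lattice spanned by `1` and `exp (2πi/3)`, the basic lattice with `g₂ = 0`. -/
noncomputable def hexagonalPair : PeriodPair where
  ω₁ := 1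
  ω₂ := Complex.exp (2 * Real.pi * Complex.I / 3)
  indep := by
    have him : (Complex.exp (2 * Real.pi * Complex.I / 3)).im ≠ 0 := by
      rw [show (2 * Real.pi * Complex.I / 3 : ℂ) = ((2 * Real.pi / 3 : ℝ) : ℂ) * Complex.I by
        push_cast; ring, Complex.exp_ofReal_mul_I_im]
      exact (Real.sin_pos_of_pos_of_lt_pi (by positivity) (by linarith [Real.pi_pos])).ne'
    refine LinearIndependent.pair_iff.2 fun s t h => ?_
    have ht : t = 0 := by simpa [him] using congrArg Complex.im h
    subst ht
    simpa using h

theorem g₂_hexagonalPair : hexagonalPair.g₂ = 0 := by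
  have hρ : IsPrimitiveRoot hexagonalPair.ω₂ 3 := Complex.isPrimitiveRoot_exp 3 (by norm_num)
  have hsum := one_add_add_sq_of_isPrimitiveRoot_three hρ
  have hmul (x : ℂ) : hexagonalPair.ω₂ * x ∈ hexagonalPair.lattice ↔ x ∈ hexagonalPair.lattice := by
    simp only [PeriodPair.mem_lattice, show hexagonalPair.ω₁ = 1 from rfl, mul_one]
    constructor
    · rintro ⟨m, n, h⟩
      refine ⟨n - m, -m, mul_left_cancel₀ (hρ.ne_zero (by norm_num)) ?_⟩
      push_cast
      linear_combination h - m * hsum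
    · rintro ⟨m, n, rfl⟩
      refine ⟨-n, m - n, ?_⟩
      push_cast
      linear_combination -n * hsum
  have hpow : hexagonalPair.ω₂ ^ 4 ≠ 1 := by
    rw [pow_succ, hρ.pow_eq_one, one_mul]
    exact hρ.ne_one (by norm_num)
  have hρ0 : hexagonalPair.ω₂ ≠ 0 := hρ.ne_zero (by norm_num)
  rw [PeriodPair.g₂, eisensteinG_eq_zero_of_mul_mem_lattice_iff hρ0 hmul hpow, mul_zero]

theorem exists_periodPair_g₂_eq_zero_g₃_eq {g : ℂ} (hg : g ≠ 0) :
    ∃ L : PeriodPair, L.g₂ = 0 ∧ L.g₃ = g := by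
  have h3 := g₃_ne_zero_of_g₂_eq_zero g₂_hexagonalPair
  obtain ⟨c, hc⟩ := IsAlgClosed.exists_pow_nat_eq (hexagonalPair.g₃ / g) (n := 6) (by norm_num)
  have hc0 : c ≠ 0 := by
    rintro rfl
    rw [zero_pow (by norm_num)] at hc
    exact div_ne_zero h3 hg hc.symm
  refine ⟨mapPair hexagonalPair (mulEquiv hc0), ?_, ?_⟩
  · rw [g₂_mapPair_mulEquiv, g₂_hexagonalPair, mul_zero]
  · rw [g₃_mapPair_mulEquiv, hc, inv_div, div_mul_cancel₀ g h3]

theorem lattice_mapPair_mulEquiv_of_pow_six (h2 : L.g₂ = 0) (hρ : ρ ^ 6 = 1) (hρ0 : ρ ≠ 0) :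
    (mapPair L (mulEquiv hρ0)).lattice = L.lattice :=
  lattice_eq_of_invariants (by rw [g₂_mapPair_mulEquiv, h2, mul_zero])
    (by rw [g₃_mapPair_mulEquiv, hρ, inv_one, one_mul])

theorem mul_mem_lattice_iff_of_pow_six (h2 : L.g₂ = 0) (hρ : ρ ^ 6 = 1) {x : ℂ} :
    ρ * x ∈ L.lattice ↔ x ∈ L.lattice := by
  have hρ0 : ρ ≠ 0 := by
    rintro rfl
    norm_num at hρ
  exact apply_mem_lattice_iff_of_eq (lattice_mapPair_mulEquiv_of_pow_six h2 hρ hρ0)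

theorem weierstrassP_mul_of_pow_six (h2 : L.g₂ = 0) (hρ : ρ ^ 6 = 1) (z : ℂ) :
    ℘[L] (ρ * z) = (ρ ^ 2)⁻¹ * ℘[L] z := by
  have hρ0 : ρ ≠ 0 := by
    rintro rfl
    norm_num at hρ
  rw [← weierstrassP_mapPair_mulEquiv hρ0,
    weierstrassP_congr (lattice_mapPair_mulEquiv_of_pow_six h2 hρ hρ0)]

/-- A zero `z` is congruent to `ρ z` or to `-ρ z` for a primitive cube root of unity `ρ`; the latter
would make `z = -ρ z - ρ² z` a period, and `3 = (ρ² - 1) (ρ - 1)`. -/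
theorem three_mul_mem_lattice_of_weierstrassP_eq_zero (h2 : L.g₂ = 0) {z : ℂ} (hz : z ∉ L.lattice)
    (h0 : ℘[L] z = 0) : 3 * z ∈ L.lattice := by
  obtain ⟨ρ, hρ⟩ : ∃ ρ : ℂ, IsPrimitiveRoot ρ 3 :=
    ⟨_, Complex.isPrimitiveRoot_exp 3 (by norm_num)⟩
  have hsum := one_add_add_sq_of_isPrimitiveRoot_three hρ
  have hmul {x : ℂ} : ρ * x ∈ L.lattice ↔ x ∈ L.lattice :=
    mul_mem_lattice_iff_of_pow_six h2 ((hρ.pow_eq_one_iff_dvd 6).2 (by norm_num))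
  have hzero : ℘[L] (ρ * z) = 0 := by
    rw [weierstrassP_mul_of_pow_six h2 ((hρ.pow_eq_one_iff_dvd 6).2 (by norm_num)), h0, mul_zero]
  rcases sub_mem_or_add_mem_lattice_of_eq (mt hmul.1 hz) hz (hzero.trans h0.symm) with h | h
  · have h3 : 3 * z = ρ * (ρ * (ρ * z - z)) - (ρ * z - z) := by
      linear_combination (2 - ρ) * z * hsum
    rw [h3]
    exact sub_mem (hmul.2 (hmul.2 h)) h
  · have hz' : -(ρ * (ρ * z)) = ρ * z + z := by linear_combination -z * hsum
    rw [← hz', neg_mem_iff, hmul, hmul] at h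
    exact absurd h hz

end EquianharmonicLattice

section Beta

theorem integral_rpow_mul_one_sub_rpow {a b : ℝ} (ha : 0 < a) (hb : 0 < b) :
    ∫ u in Ioo (0 : ℝ) 1, u ^ (a - 1) * (1 - u) ^ (b - 1) = ProbabilityTheory.beta a b := by
  have hcast : ∀ u ∈ Ioo (0 : ℝ) 1, (u : ℂ) ^ ((a : ℂ) - 1) * (1 - u) ^ ((b : ℂ) - 1) =
      ((u ^ (a - 1) * (1 - u) ^ (b - 1) : ℝ) : ℂ) := by
    intro u hu
    rw [Complex.ofReal_mul, Complex.ofReal_cpow hu.1.le, Complex.ofReal_cpow (sub_nonneg.2 hu.2.le)]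
    push_cast
    rfl
  rw [ProbabilityTheory.beta_eq_betaIntegralReal a b ha hb, Complex.betaIntegral,
    intervalIntegral.integral_of_le zero_le_one, MeasureTheory.integral_Ioc_eq_integral_Ioo,
    MeasureTheory.setIntegral_congr_fun measurableSet_Ioo hcast, integral_complex_ofReal,
    Complex.ofReal_re]

theorem image_rpow_Ioo_zero_one {p : ℝ} (hp : 0 < p) :
    (fun x : ℝ => x ^ p) '' Ioo 0 1 = Ioo 0 1 := by
  ext u
  constructor
  · rintro ⟨x, hx, rfl⟩
    exact ⟨Real.rpow_pos_of_pos hx.1 p, Real.rpow_lt_one hx.1.le hx.2 hp⟩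
  · intro hu
    exact ⟨u ^ p⁻¹, ⟨Real.rpow_pos_of_pos hu.1 _, Real.rpow_lt_one hu.1.le hu.2 (inv_pos.2 hp)⟩,
      Real.rpow_inv_rpow hu.1.le hp.ne'⟩

theorem integral_one_sub_rpow_rpow {p b : ℝ} (hp : 0 < p) (hb : 0 < b) :
    p * ∫ x in Ioo (0 : ℝ) 1, (1 - x ^ p) ^ (b - 1) = ProbabilityTheory.beta p⁻¹ b := by
  have hinj : InjOn (fun x : ℝ => x ^ p) (Ioo 0 1) :=
    (Real.rpow_left_injOn hp.ne').mono fun x hx => hx.1.le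
  have hsubst := MeasureTheory.integral_image_eq_integral_abs_deriv_smul measurableSet_Ioo
    (fun x hx => (Real.hasDerivAt_rpow_const (p := p) (.inl hx.1.ne')).hasDerivWithinAt) hinj
    fun u => u ^ (p⁻¹ - 1) * (1 - u) ^ (b - 1)
  rw [image_rpow_Ioo_zero_one hp, integral_rpow_mul_one_sub_rpow (inv_pos.2 hp) hb] at hsubst
  rw [hsubst, ← MeasureTheory.integral_const_mul]
  refine MeasureTheory.setIntegral_congr_fun measurableSet_Ioo fun x hx => ?_
  have hcancel : x ^ (p - 1) * (x ^ p) ^ (p⁻¹ - 1) = 1 := by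
    rw [← Real.rpow_mul hx.1.le, ← Real.rpow_add hx.1,
      show p - 1 + p * (p⁻¹ - 1) = 0 by field_simp; ring, Real.rpow_zero]
  have hpos : 0 < p * x ^ (p - 1) := mul_pos hp (Real.rpow_pos_of_pos hx.1 _)
  simp only [smul_eq_mul, abs_of_pos hpos]
  linear_combination -p * (1 - x ^ p) ^ (b - 1) * hcancel

theorem piThree_eq_beta : piThree = ProbabilityTheory.beta (1 / 3) (1 / 3) := by
  have h := integral_one_sub_rpow_rpow (p := 3) (b := 1 / 3) (by norm_num) (by norm_num)
  rw [← one_div] at h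
  rw [← h, piThree, intervalIntegral.integral_of_le zero_le_one,
    MeasureTheory.integral_Ioc_eq_integral_Ioo]
  congr 1
  refine MeasureTheory.setIntegral_congr_fun measurableSet_Ioo fun y hy => ?_
  have h1 : 0 ≤ 1 - y ^ 3 := sub_nonneg.2 (pow_le_one₀ hy.1.le hy.2.le)
  rw [Real.rpow_ofNat, show (1 / 3 - 1 : ℝ) = -(2 / 3) by norm_num, Real.rpow_neg h1, one_div]

theorem Gamma_one_third_mul_Gamma_two_thirds :
    Real.Gamma (1 / 3) * Real.Gamma (2 / 3) = 2 * Real.pi / Real.sqrt 3 := by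
  have h := Real.Gamma_mul_Gamma_one_sub (1 / 3)
  rw [show (1 : ℝ) - 1 / 3 = 2 / 3 by norm_num, mul_one_div, Real.sin_pi_div_three] at h
  rw [h, div_div_eq_mul_div, mul_comm]

theorem piThree_eq_Gamma :
    piThree = (3 : ℝ) ^ (1 / 2 : ℝ) / (2 * Real.pi) * Real.Gamma (1 / 3) ^ 3 := by
  have hΓ : Real.Gamma (2 / 3) ≠ 0 := (Real.Gamma_pos_of_pos (by norm_num)).ne'
  have hrefl := Gamma_one_third_mul_Gamma_two_thirds
  rw [eq_div_iff (by positivity)] at hrefl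
  rw [piThree_eq_beta, ProbabilityTheory.beta, show (1 / 3 + 1 / 3 : ℝ) = 2 / 3 by norm_num,
    ← Real.sqrt_eq_rpow]
  field_simp [hΓ]
  linear_combination -hrefl

theorem piThree_mul_two_rpow :
    piThree * (2 : ℝ) ^ (-(1 / 3) : ℝ) =
      (2 : ℝ) ^ (-(4 / 3) : ℝ) * (3 : ℝ) ^ (1 / 2 : ℝ) / Real.pi * Real.Gamma (1 / 3) ^ 3 := by
  rw [piThree_eq_Gamma, show (-(4 / 3) : ℝ) = -(1 / 3) + -1 by norm_num,
    Real.rpow_add (by norm_num), Real.rpow_neg_one]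
  field_simp

end Beta

section RealLattice

/-- The period lattice is stable under complex conjugation, so that `℘` and `℘'` are real on the
real axis. -/
def IsRealLattice (L : PeriodPair) : Prop := ∀ x, conj x ∈ L.lattice ↔ x ∈ L.lattice

/-- `T` is the least positive real period of `℘`, expressed through the period lattice. -/
def IsLeastRealPeriod (L : PeriodPair) (T : ℝ) : Prop :=
  IsLeast {t : ℝ | 0 < t ∧ (t : ℂ) ∈ L.lattice} T

/-- The restriction of `℘` to the real axis, as a real function; it is meant for real lattices. -/
noncomputable def realP (L : PeriodPair) (x : ℝ) : ℝ := (℘[L] x).re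

/-- The restriction of `℘'` to the real axis, as a real function; it is meant for real lattices. -/
noncomputable def realDerivP (L : PeriodPair) (x : ℝ) : ℝ := (℘'[L] x).re

variable {L : PeriodPair} {T x : ℝ}

theorem isRealLattice_of_conj_invariants (h2 : conj L.g₂ = L.g₂) (h3 : conj L.g₃ = L.g₃) :
    IsRealLattice L := by
  refine fun x => apply_mem_lattice_iff_of_eq (σ := Complex.conjAe.toLinearEquiv)
    (lattice_eq_of_invariants ?_ ?_)
  · rw [← h2, PeriodPair.g₂, PeriodPair.g₂, eisensteinG_mapPair_conj, map_mul, Complex.conj_ofNat]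
  · rw [← h3, PeriodPair.g₃, PeriodPair.g₃, eisensteinG_mapPair_conj, map_mul, Complex.conj_ofNat]

theorem hasDerivAt_realP (hx : (x : ℂ) ∉ L.lattice) : HasDerivAt (realP L) (realDerivP L x) x :=
  (hasDerivAt_weierstrassP hx).real_of_complex

theorem tendsto_realP_nhdsGT_zero (L : PeriodPair) : Tendsto (realP L) (𝓝[>] 0) atTop := by
  have hbdd : Tendsto (fun x : ℝ => (L.weierstrassPExcept 0 x).re) (𝓝[>] 0) (𝓝 0) := by
    have hcont : ContinuousAt (L.weierstrassPExcept 0) ((0 : ℝ) : ℂ) :=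
      (L.analyticAt_weierstrassPExcept 0).continuousAt
    have hre := Complex.continuous_re.continuousAt.comp
      (hcont.comp Complex.continuous_ofReal.continuousAt)
    simpa [ContinuousAt, Function.comp_def] using hre.tendsto.mono_left nhdsWithin_le_nhds
  have hpole : Tendsto (fun x : ℝ => (x ^ 2)⁻¹) (𝓝[>] 0) atTop := by
    simpa only [← inv_pow, Function.comp_def] using
      (tendsto_pow_atTop two_ne_zero).comp tendsto_inv_nhdsGT_zero
  refine (hbdd.add_atTop hpole).congr fun x => ?_
  rw [realP, weierstrassP_eq_weierstrassPExcept_add, Complex.add_re, one_div]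
  norm_cast

theorem realDerivP_half_period (hT : (T : ℂ) ∈ L.lattice) : realDerivP L (T / 2) = 0 := by
  rw [realDerivP, Complex.ofReal_div, Complex.ofReal_ofNat, derivWeierstrassP_half_period hT,
    Complex.zero_re]

theorem realP_period_sub (hT : (T : ℂ) ∈ L.lattice) (x : ℝ) : realP L (T - x) = realP L x := by
  rw [realP, realP, ← L.weierstrassP_neg, ← L.weierstrassP_add_coe _ ⟨T, hT⟩]
  congr 2
  push_cast
  ring

theorem realDerivP_period_sub (hT : (T : ℂ) ∈ L.lattice) (x : ℝ) :
    realDerivP L (T - x) = -realDerivP L x := by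
  rw [realDerivP, realDerivP, ← Complex.neg_re, ← L.derivWeierstrassP_neg,
    ← L.derivWeierstrassP_add_coe (-x) ⟨T, hT⟩]
  congr 2
  push_cast
  ring

theorem exists_isLeastRealPeriod (h : ∃ t : ℝ, t ≠ 0 ∧ (t : ℂ) ∈ L.lattice) :
    ∃ T, IsLeastRealPeriod L T := by
  let H : AddSubgroup ℝ := L.lattice.toAddSubgroup.comap Complex.ofRealHom.toAddMonoidHom
  have hH (t : ℝ) : t ∈ H ↔ (t : ℂ) ∈ L.lattice := Iff.rfl
  have hbot : H ≠ ⊥ := fun hbot => by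
    obtain ⟨t, ht0, ht⟩ := h
    exact ht0 (by simpa only [hbot, AddSubgroup.mem_bot] using (hH t).2 ht)
  obtain ⟨ε, hε, hball⟩ := Metric.mem_nhdsWithin_iff.1 (eventually_notMem_lattice_nhdsNE L 0)
  have hdisj : Disjoint (H : Set ℝ) (Ioo 0 ε) := by
    refine Set.disjoint_left.2 fun t ht ht' => hball (a := (t : ℂ)) ⟨?_, ?_⟩ ((hH t).1 ht)
    · simpa [abs_of_pos ht'.1] using ht'.2
    · simpa using ht'.1.ne'
  obtain ⟨T, hT⟩ := AddSubgroup.exists_isLeast_pos hbot hε hdisj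
  exact ⟨T, ⟨hT.1.2, (hH T).1 hT.1.1⟩, fun t ht => hT.2 ⟨(hH t).2 ht.2, ht.1⟩⟩

namespace IsLeastRealPeriod

variable (hT : IsLeastRealPeriod L T)

include hT

theorem pos : 0 < T := hT.1.1

theorem mem_lattice : (T : ℂ) ∈ L.lattice := hT.1.2

theorem notMem_lattice (hx : x ∈ Ioo 0 T) : (x : ℂ) ∉ L.lattice :=
  fun h => (hT.2 ⟨hx.1, h⟩).not_gt hx.2

theorem eq_of_mem_lattice (hx : (x : ℂ) ∈ L.lattice) (h0 : 0 < x) (h2 : x < 2 * T) : x = T := by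
  refine le_antisymm (le_of_not_gt fun hlt => ?_) (hT.2 ⟨h0, hx⟩)
  refine hT.notMem_lattice (x := x - T) ⟨by linarith, by linarith⟩ ?_
  rw [Complex.ofReal_sub]
  exact sub_mem hx hT.mem_lattice

end IsLeastRealPeriod

namespace IsRealLattice

variable (hL : IsRealLattice L)

include hL

theorem lattice_mapPair_conj : (mapPair L Complex.conjAe.toLinearEquiv).lattice = L.lattice :=
  lattice_mapPair_eq hL

theorem ofReal_realP (x : ℝ) : (realP L x : ℂ) = ℘[L] x := by
  have h := weierstrassP_mapPair_conj (L := L) x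
  rw [weierstrassP_congr hL.lattice_mapPair_conj, Complex.conj_ofReal] at h
  exact Complex.conj_eq_iff_re.1 h.symm

theorem ofReal_realDerivP (x : ℝ) : (realDerivP L x : ℂ) = ℘'[L] x := by
  have h := derivWeierstrassP_mapPair_conj (L := L) x
  rw [derivWeierstrassP_congr hL.lattice_mapPair_conj, Complex.conj_ofReal] at h
  exact Complex.conj_eq_iff_re.1 h.symm

theorem realDerivP_sq (hx : (x : ℂ) ∉ L.lattice) :
    realDerivP L x ^ 2 = 4 * realP L x ^ 3 - L.g₂.re * realP L x - L.g₃.re := by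
  have h := L.derivWeierstrassP_sq x hx
  rw [← hL.ofReal_realP, ← hL.ofReal_realDerivP] at h
  have hre := congrArg Complex.re h
  simpa [← Complex.ofReal_pow, ← Complex.ofReal_ofNat] using hre

theorem hasDerivAt_realDerivP (hx : (x : ℂ) ∉ L.lattice) :
    HasDerivAt (realDerivP L) (6 * realP L x ^ 2 - L.g₂.re / 2) x := by
  have h : HasDerivAt (realDerivP L) _ x := (hasDerivAt_derivWeierstrassP hx).real_of_complex
  rw [← hL.ofReal_realP] at h
  simpa [← Complex.ofReal_pow, ← Complex.ofReal_ofNat] using h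

theorem two_mul_re_mem_lattice {l : ℂ} (hl : l ∈ L.lattice) :
    ((2 * l.re : ℝ) : ℂ) ∈ L.lattice := by
  rw [← Complex.add_conj]
  exact add_mem hl ((hL l).2 hl)

theorem exists_isLeastRealPeriod : ∃ T, IsLeastRealPeriod L T := by
  refine PseudoFactorial.exists_isLeastRealPeriod ?_
  by_contra! h
  have hre {l : ℂ} (hl : l ∈ L.lattice) : l.re = 0 := by
    by_contra h0
    exact h (2 * l.re) (mul_ne_zero two_ne_zero h0) (hL.two_mul_re_mem_lattice hl)
  have h₁ := hre L.ω₁_mem_lattice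
  have h₂ := hre L.ω₂_mem_lattice
  have hcoeff := LinearIndependent.pair_iff.1 L.indep L.ω₂.im (-L.ω₁.im)
    (by apply Complex.ext <;> simp [h₁, h₂, mul_comm])
  exact L.indep.ne_zero 0 (Complex.ext h₁ (neg_eq_zero.1 hcoeff.2))

theorem injOn_realP (hT : IsLeastRealPeriod L T) : InjOn (realP L) (Ioc 0 (T / 2)) := by
  intro a ha b hb hab
  have hpos := hT.pos
  have hmem : ∀ y ∈ Ioc 0 (T / 2), (y : ℂ) ∉ L.lattice :=
    fun y hy => hT.notMem_lattice ⟨hy.1, by linarith [hy.2]⟩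
  have hab' : ℘[L] a = ℘[L] b := by rw [← hL.ofReal_realP, ← hL.ofReal_realP, hab]
  rcases sub_mem_or_add_mem_lattice_of_eq (hmem a ha) (hmem b hb) hab' with h | h
  · rcases lt_trichotomy a b with hlt | heq | hlt
    · rw [← neg_mem_iff, neg_sub, ← Complex.ofReal_sub] at h
      exact absurd h (hT.notMem_lattice ⟨sub_pos.2 hlt, by linarith [ha.1, hb.2]⟩)
    · exact heq
    · rw [← Complex.ofReal_sub] at h
      exact absurd h (hT.notMem_lattice ⟨sub_pos.2 hlt, by linarith [hb.1, ha.2]⟩)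
  · rw [← Complex.ofReal_add] at h
    have := hT.eq_of_mem_lattice h (add_pos ha.1 hb.1) (by linarith [ha.2, hb.2])
    linarith [ha.2, hb.2]

end IsRealLattice

end RealLattice

section RealPeriod

variable {L : PeriodPair} {T x : ℝ}

theorem image_Ioo_of_strictMonoOn {α β : Type*} [ConditionallyCompleteLinearOrder α]
    [TopologicalSpace α] [OrderTopology α] [DenselyOrdered α] [LinearOrder β] [TopologicalSpace β]
    [OrderClosedTopology β] {f : α → β} {a b : α} (hab : a ≤ b)
    (hf : ContinuousOn f (Icc a b)) (hmono : StrictMonoOn f (Icc a b)) :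
    f '' Ioo a b = Ioo (f a) (f b) := by
  refine Subset.antisymm ?_ (intermediate_value_Ioo hab hf)
  rintro _ ⟨x, hx, rfl⟩
  exact ⟨hmono (left_mem_Icc.2 hab) (Ioo_subset_Icc_self hx) hx.1,
    hmono (Ioo_subset_Icc_self hx) (right_mem_Icc.2 hab) hx.2⟩

/-- On the curve `d² = 4p³ + 4` the substitution `u = (2 + d) / 4` gives
`u (1 - u) = (-p)³ / 4`. -/
theorem sq_mul_rpow_mul_rpow_of_sq_eq {p d : ℝ} (hd : d ∈ Ioo (-2) 2)
    (h : d ^ 2 = 4 * p ^ 3 + 4) :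
    p ^ 2 * (((2 + d) / 4) ^ (1 / 3 - 1 : ℝ) * (1 - (2 + d) / 4) ^ (1 / 3 - 1 : ℝ)) =
      (4 : ℝ) ^ (2 / 3 : ℝ) := by
  have hp : 0 < -p := by
    by_contra! hcon
    have : 0 ≤ p ^ 3 := pow_nonneg (by linarith) 3
    nlinarith [hd.1, hd.2]
  have hu : (2 + d) / 4 * (1 - (2 + d) / 4) = (-p) ^ (3 : ℝ) / 4 := by
    rw [Real.rpow_ofNat]
    linear_combination -h / 16
  have hexp : ((-p) ^ (3 : ℝ)) ^ (1 / 3 - 1 : ℝ) = (p ^ 2)⁻¹ := by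
    rw [← Real.rpow_mul hp.le, show (3 * (1 / 3 - 1) : ℝ) = -2 by norm_num, Real.rpow_neg hp.le,
      Real.rpow_ofNat, neg_sq]
  rw [← Real.mul_rpow (by linarith [hd.1]) (by linarith [hd.2]), hu,
    Real.div_rpow (Real.rpow_nonneg hp.le _) (by norm_num), hexp,
    show (1 / 3 - 1 : ℝ) = -(2 / 3) by norm_num, Real.rpow_neg (by norm_num)]
  have hp0 : p ≠ 0 := by linarith
  field_simp

variable (h2 : L.g₂ = 0) (h3 : L.g₃ = -4)

include h2 h3

theorem isRealLattice_of_g₂_eq_zero_g₃_eq : IsRealLattice L :=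
  isRealLattice_of_conj_invariants (by rw [h2, map_zero])
    (by rw [h3, map_neg, Complex.conj_ofNat])

theorem realDerivP_sq_eq (hx : (x : ℂ) ∉ L.lattice) :
    realDerivP L x ^ 2 = 4 * realP L x ^ 3 + 4 := by
  simpa [h2, h3] using (isRealLattice_of_g₂_eq_zero_g₃_eq h2 h3).realDerivP_sq hx

variable (hT : IsLeastRealPeriod L T)

include hT

theorem realP_half_period : realP L (T / 2) = -1 := by
  have h := realDerivP_sq_eq h2 h3 (hT.notMem_lattice ⟨half_pos hT.pos, half_lt_self hT.pos⟩)
  rw [realDerivP_half_period hT.mem_lattice] at h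
  refine (Odd.strictMono_pow (by decide : Odd 3)).injective ?_
  linear_combination -h / 4

theorem exists_realP_eq_zero : ∃ x ∈ Ioo 0 (T / 2), realP L x = 0 := by
  have hhalf := realP_half_period h2 h3 hT
  obtain ⟨a, ha, ha'⟩ := (((tendsto_realP_nhdsGT_zero L).eventually_gt_atTop 0).and
    (Ioo_mem_nhdsGT (half_pos hT.pos))).exists
  have hcont : ContinuousOn (realP L) (Icc a (T / 2)) := fun x hx =>
    (hasDerivAt_realP (hT.notMem_lattice ⟨ha'.1.trans_le hx.1,
      hx.2.trans_lt (half_lt_self hT.pos)⟩)).continuousAt.continuousWithinAt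
  obtain ⟨x, hx, hx0⟩ := intermediate_value_Ioo' ha'.2.le hcont
    (show (0 : ℝ) ∈ Ioo (realP L (T / 2)) (realP L a) from ⟨by linarith, ha⟩)
  exact ⟨x, ⟨ha'.1.trans hx.1, hx.2⟩, hx0⟩

theorem realP_third_period : realP L (T / 3) = 0 := by
  obtain ⟨x, hx, hx0⟩ := exists_realP_eq_zero h2 h3 hT
  have hzero : ℘[L] x = 0 := by
    rw [← (isRealLattice_of_g₂_eq_zero_g₃_eq h2 h3).ofReal_realP, hx0, Complex.ofReal_zero]
  have h3x : ((3 * x : ℝ) : ℂ) ∈ L.lattice := by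
    push_cast
    exact three_mul_mem_lattice_of_weierstrassP_eq_zero h2
      (hT.notMem_lattice ⟨hx.1, by linarith [hx.2, hT.pos]⟩) hzero
  have hxT := hT.eq_of_mem_lattice h3x (by linarith [hx.1]) (by linarith [hx.2, hT.pos])
  rwa [← hxT, mul_div_cancel_left₀ _ three_ne_zero]

theorem realP_ne_zero (hx : x ∈ Ioo (T / 3) (2 * T / 3)) : realP L x ≠ 0 := by
  have hleft : ∀ y ∈ Ioc (T / 3) (T / 2), realP L y ≠ 0 := fun y hy h => by
    have hpos := hT.pos
    have hzero := realP_third_period h2 h3 hT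
    exact hy.1.ne' ((isRealLattice_of_g₂_eq_zero_g₃_eq h2 h3).injOn_realP hT
      ⟨by linarith [hy.1], hy.2⟩ ⟨by linarith, by linarith⟩ (h.trans hzero.symm))
  rcases le_or_gt x (T / 2) with h | h
  · exact hleft x ⟨hx.1, h⟩
  · rw [← realP_period_sub hT.mem_lattice]
    exact hleft _ ⟨by linarith [hx.2], by linarith⟩

theorem hasDerivAt_realDerivP_of_mem_Icc (hx : x ∈ Icc (T / 3) (2 * T / 3)) :
    HasDerivAt (realDerivP L) (6 * realP L x ^ 2) x := by
  have hxL : (x : ℂ) ∉ L.lattice :=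
    hT.notMem_lattice ⟨by linarith [hx.1, hT.pos], by linarith [hx.2, hT.pos]⟩
  simpa [h2] using (isRealLattice_of_g₂_eq_zero_g₃_eq h2 h3).hasDerivAt_realDerivP hxL

theorem continuousOn_realDerivP : ContinuousOn (realDerivP L) (Icc (T / 3) (2 * T / 3)) :=
  fun _ hx => (hasDerivAt_realDerivP_of_mem_Icc h2 h3 hT hx).continuousAt.continuousWithinAt

theorem strictMonoOn_realDerivP : StrictMonoOn (realDerivP L) (Icc (T / 3) (2 * T / 3)) := by
  refine strictMonoOn_of_deriv_pos (convex_Icc _ _) (continuousOn_realDerivP h2 h3 hT)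
    fun x hx => ?_
  rw [interior_Icc] at hx
  rw [(hasDerivAt_realDerivP_of_mem_Icc h2 h3 hT (Ioo_subset_Icc_self hx)).deriv]
  have := realP_ne_zero h2 h3 hT hx
  positivity

theorem realDerivP_third_period : realDerivP L (T / 3) = -2 := by
  have hpos := hT.pos
  have hsq := realDerivP_sq_eq h2 h3 (x := T / 3)
    (hT.notMem_lattice ⟨by linarith, by linarith⟩)
  rw [realP_third_period h2 h3 hT] at hsq
  have hneg : realDerivP L (T / 3) < realDerivP L (T / 2) :=
    strictMonoOn_realDerivP h2 h3 hT ⟨le_rfl, by linarith⟩ ⟨by linarith, by linarith⟩ (by linarith)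
  rw [realDerivP_half_period hT.mem_lattice] at hneg
  nlinarith

theorem image_realDerivP_Ioo :
    realDerivP L '' Ioo (T / 3) (2 * T / 3) = Ioo (-2) 2 := by
  rw [image_Ioo_of_strictMonoOn (by linarith [hT.pos]) (continuousOn_realDerivP h2 h3 hT)
    (strictMonoOn_realDerivP h2 h3 hT), show 2 * T / 3 = T - T / 3 by ring,
    realDerivP_period_sub hT.mem_lattice, realDerivP_third_period h2 h3 hT, neg_neg]

theorem image_two_add_realDerivP_div_four_Ioo :
    (fun x => (2 + realDerivP L x) / 4) '' Ioo (T / 3) (2 * T / 3) = Ioo 0 1 := by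
  rw [← image_image (fun d : ℝ => (2 + d) / 4), image_realDerivP_Ioo h2 h3 hT,
    ← image_image (fun d : ℝ => d / 4) (fun d => 2 + d), image_const_add_Ioo]
  simp only [div_eq_mul_inv]
  rw [image_mul_right_Ioo _ _ (by norm_num)]
  norm_num

theorem beta_one_third_eq_mul_period :
    ProbabilityTheory.beta (1 / 3) (1 / 3) = 3 / 2 * (4 : ℝ) ^ (2 / 3 : ℝ) * (T / 3) := by
  have hinj : InjOn (fun x => (2 + realDerivP L x) / 4) (Ioo (T / 3) (2 * T / 3)) :=
    fun a ha b hb hab => (strictMonoOn_realDerivP h2 h3 hT).injOn (Ioo_subset_Icc_self ha)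
      (Ioo_subset_Icc_self hb) (by simpa using hab)
  have hsubst := MeasureTheory.integral_image_eq_integral_abs_deriv_smul measurableSet_Ioo
    (fun x hx => (((hasDerivAt_realDerivP_of_mem_Icc h2 h3 hT (Ioo_subset_Icc_self hx)).const_add
      2).div_const 4).hasDerivWithinAt) hinj
    fun u => u ^ (1 / 3 - 1 : ℝ) * (1 - u) ^ (1 / 3 - 1 : ℝ)
  have hconst : ∀ x ∈ Ioo (T / 3) (2 * T / 3), |6 * realP L x ^ 2 / 4| •
      (((2 + realDerivP L x) / 4) ^ (1 / 3 - 1 : ℝ) *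
        (1 - (2 + realDerivP L x) / 4) ^ (1 / 3 - 1 : ℝ)) = 3 / 2 * (4 : ℝ) ^ (2 / 3 : ℝ) := by
    intro x hx
    have hxL := hT.notMem_lattice (x := x) ⟨by linarith [hx.1, hT.pos], by linarith [hx.2, hT.pos]⟩
    have hd : realDerivP L x ∈ Ioo (-2) 2 :=
      image_realDerivP_Ioo h2 h3 hT ▸ mem_image_of_mem _ hx
    rw [smul_eq_mul, abs_of_nonneg (by positivity)]
    linear_combination 3 / 2 * sq_mul_rpow_mul_rpow_of_sq_eq hd (realDerivP_sq_eq h2 h3 hxL)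
  rw [image_two_add_realDerivP_div_four_Ioo h2 h3 hT,
    integral_rpow_mul_one_sub_rpow (by norm_num) (by norm_num),
    MeasureTheory.setIntegral_congr_fun measurableSet_Ioo hconst, MeasureTheory.setIntegral_const,
    Real.volume_real_Ioo_of_le (by linarith [hT.pos]), smul_eq_mul] at hsubst
  linear_combination hsubst

theorem leastRealPeriod_eq_piThree_mul : T = piThree * (2 : ℝ) ^ (-(1 / 3) : ℝ) := by
  have hpow : (4 : ℝ) ^ (2 / 3 : ℝ) * (2 : ℝ) ^ (-(1 / 3) : ℝ) = 2 := by
    rw [show (4 : ℝ) = 2 ^ (2 : ℝ) by norm_num, ← Real.rpow_mul (by norm_num),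
      ← Real.rpow_add (by norm_num)]
    norm_num
  rw [piThree_eq_beta, beta_one_third_eq_mul_period h2 h3 hT]
  linear_combination -T / 2 * hpow

end RealPeriod

section Series

theorem abs_pseudoFactorial_le (n : ℕ) : |pseudoFactorial n| ≤ n.factorial := by
  induction n using Nat.strong_induction_on with
  | _ n ih =>
    rcases n with _ | n
    · simp [pseudoFactorial]
    have hterm : ∀ k ∈ Finset.range (n + 1),
        |(n.choose k : ℤ) * pseudoFactorial k * pseudoFactorial (n - k)| ≤ n.factorial := by
      intro k hk
      have hkn : k ≤ n := Nat.lt_succ_iff.1 (Finset.mem_range.1 hk)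
      have hk := ih k (by lia)
      have hnk := ih (n - k) (by lia)
      rw [abs_mul, abs_mul, Nat.abs_cast, ← Nat.choose_mul_factorial_mul_factorial hkn]
      push_cast
      gcongr
    rw [pseudoFactorial_succ, abs_mul, abs_neg_one_pow, one_mul, Nat.factorial_succ, Nat.cast_mul]
    refine (Finset.abs_sum_le_sum_abs _ _).trans
      ((Finset.sum_le_card_nsmul _ _ _ hterm).trans_eq ?_)
    rw [Finset.card_range, nsmul_eq_mul]

/-- The power series `∑ αₙ wⁿ / n!`. -/
noncomputable def pseudoFactorialSeries : FormalMultilinearSeries ℂ ℂ ℂ :=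
  .ofScalars ℂ fun n => (pseudoFactorial n : ℂ) / n.factorial

theorem pseudoFactorialSeries_apply (w : ℂ) (n : ℕ) :
    (pseudoFactorialSeries n fun _ => w) =
      (pseudoFactorial n : ℂ) * w ^ n / (n.factorial : ℂ) := by
  rw [pseudoFactorialSeries, FormalMultilinearSeries.ofScalars_apply_eq, smul_eq_mul]
  ring

theorem one_le_radius_pseudoFactorialSeries : 1 ≤ pseudoFactorialSeries.radius := by
  have h := pseudoFactorialSeries.le_radius_of_bound (r := 1) 1 fun n => by
    rw [pseudoFactorialSeries, FormalMultilinearSeries.ofScalars_norm, norm_div,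
      Complex.norm_intCast, Complex.norm_natCast, NNReal.coe_one, one_pow, mul_one]
    refine div_le_one_of_le₀ ?_ (by positivity)
    exact_mod_cast abs_pseudoFactorial_le n
  exact_mod_cast h

theorem mem_eball_zero_one_iff {E : Type*} [SeminormedAddCommGroup E] {w : E} :
    w ∈ Metric.eball (0 : E) 1 ↔ ‖w‖ < 1 := by
  rw [← ENNReal.ofReal_one, Metric.eball_ofReal, mem_ball_zero_iff]

theorem hasFPowerSeriesOnBall_pseudoFactorialSeries_iff {f : ℂ → ℂ} :
    HasFPowerSeriesOnBall f pseudoFactorialSeries 0 1 ↔ ∀ w : ℂ, ‖w‖ < 1 →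
      HasSum (fun n : ℕ => (pseudoFactorial n : ℂ) * w ^ n / (n.factorial : ℂ)) (f w) := by
  simp only [← mem_eball_zero_one_iff, ← pseudoFactorialSeries_apply]
  refine ⟨fun h w hw => by simpa only [zero_add] using h.hasSum hw, fun h => ?_⟩
  exact ⟨one_le_radius_pseudoFactorialSeries, one_pos, fun hw => by
    simpa only [zero_add] using h _ hw⟩

theorem iteratedDeriv_eq_pseudoFactorial {R : ℂ → ℂ} (hR : AnalyticAt ℂ R 0) (h0 : R 0 = 1)
    (hd : ∀ᶠ w in 𝓝 0, deriv R w = -(R (-w) * R (-w))) (n : ℕ) :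
    iteratedDeriv n R 0 = pseudoFactorial n := by
  induction n using Nat.strong_induction_on with
  | _ n ih =>
    rcases n with _ | n
    · simp [pseudoFactorial, h0]
    have hleibniz : iteratedDeriv n (fun w => R w * R w) 0 = ∑ i ∈ Finset.range (n + 1),
        (n.choose i : ℂ) * pseudoFactorial i * pseudoFactorial (n - i) := by
      rw [iteratedDeriv_fun_mul hR.contDiffAt hR.contDiffAt]
      refine Finset.sum_congr rfl fun i hi => ?_
      have := Finset.mem_range.1 hi
      rw [ih i (by lia), ih (n - i) (by lia)]
    rw [iteratedDeriv_succ', EventuallyEq.iteratedDeriv_eq n hd, iteratedDeriv_fun_neg,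
      iteratedDeriv_comp_neg n (fun w => R w * R w), neg_zero, hleibniz, pseudoFactorial_succ,
      smul_eq_mul]
    push_cast
    ring

theorem hasFPowerSeriesAt_pseudoFactorialSeries {R : ℂ → ℂ} (hR : AnalyticAt ℂ R 0)
    (h0 : R 0 = 1) (hd : ∀ᶠ w in 𝓝 0, deriv R w = -(R (-w) * R (-w))) :
    HasFPowerSeriesAt R pseudoFactorialSeries 0 := by
  have h := hR.hasFPowerSeriesAt
  simp only [iteratedDeriv_eq_pseudoFactorial hR h0 hd] at h
  exact h

theorem eventuallyEq_of_hasFPowerSeriesAt {𝕜 E F : Type*} [NontriviallyNormedField 𝕜]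
    [NormedAddCommGroup E] [NormedSpace 𝕜 E] [NormedAddCommGroup F] [NormedSpace 𝕜 F]
    {f g : E → F} {p : FormalMultilinearSeries 𝕜 E F} {x : E} (hf : HasFPowerSeriesAt f p x)
    (hg : HasFPowerSeriesAt g p x) : f =ᶠ[𝓝 x] g := by
  filter_upwards [hf.eventually_hasSum_sub, hg.eventually_hasSum_sub] with w hfw hgw
  exact hfw.unique hgw

theorem exists_isPseudoFactorialEGF_of_hasFPowerSeriesAt {R : ℂ → ℂ} (hR : Meromorphic R)
    (hRs : HasFPowerSeriesAt R pseudoFactorialSeries 0) : ∃ f, IsPseudoFactorialEGF f := by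
  have hRm : MeromorphicOn R univ := meromorphicOn_univ.2 hR
  have hNF := meromorphicNFOn_toMeromorphicNFOn R univ
  have hsum : HasFPowerSeriesOnBall pseudoFactorialSeries.sum pseudoFactorialSeries 0 1 :=
    (pseudoFactorialSeries.hasFPowerSeriesOnBall
      (one_pos.trans_le one_le_radius_pseudoFactorialSeries)).mono one_pos
      one_le_radius_pseudoFactorialSeries
  have hpre : IsPreconnected (Metric.eball (0 : ℂ) 1) := by
    rw [← ENNReal.ofReal_one, Metric.eball_ofReal]
    exact (convex_ball 0 1).isPreconnected
  have hzero : toMeromorphicNFOn R univ =ᶠ[𝓝[≠] 0] pseudoFactorialSeries.sum :=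
    (hRm.toMeromorphicNFOn_eq_self_on_nhdsNE (mem_univ 0)).trans
      ((eventuallyEq_of_hasFPowerSeriesAt hRs hsum.hasFPowerSeriesAt).filter_mono
        nhdsWithin_le_nhds)
  have hEqOn : EqOn pseudoFactorialSeries.sum (toMeromorphicNFOn R univ) (Metric.eball 0 1) :=
    fun w hw => (eq_of_eventuallyEq_nhdsNE (hNF (mem_univ w))
      (hsum.analyticOnNhd w hw).meromorphicNFAt
      (eventuallyEq_nhdsNE_of_isPreconnected (hNF.meromorphicOn.mono_set (subset_univ _))
        hsum.analyticOnNhd.meromorphicOn hpre (Metric.mem_eball_self one_pos) hw hzero)).symm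
  exact ⟨_, hNF, hasFPowerSeriesOnBall_pseudoFactorialSeries_iff.1 (hsum.congr hEqOn)⟩

theorem egf_eq_of_hasFPowerSeriesAt {f R : ℂ → ℂ} {w : ℂ}
    (hf : IsPseudoFactorialEGF f) (hR : Meromorphic R)
    (hRs : HasFPowerSeriesAt R pseudoFactorialSeries 0) (hw : MeromorphicNFAt R w) :
    f w = R w := by
  have hzero := eventuallyEq_of_hasFPowerSeriesAt
    (hasFPowerSeriesOnBall_pseudoFactorialSeries_iff.2 hf.2).hasFPowerSeriesAt hRs
  exact eq_of_eventuallyEq_nhdsNE (hf.1 (mem_univ w)) hw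
    (eventuallyEq_nhdsNE_of_isPreconnected hf.1.meromorphicOn (meromorphicOn_univ.2 hR)
      isPreconnected_univ (mem_univ 0) (mem_univ w) (hzero.filter_mono nhdsWithin_le_nhds))

end Series

section EllipticQuotient

/-- The elliptic function `(-℘' - 2κ) / (2κ℘)`. For `κ² = -3` and after translation by a
half-period it is the generating function of the pseudo-factorials in the variable `w = κ z`. -/
noncomputable def egfQuotient (L : PeriodPair) (κ z : ℂ) : ℂ :=
  (-℘'[L] z - 2 * κ) / (2 * κ * ℘[L] z)

variable {L : PeriodPair} {κ a z : ℂ}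

theorem meromorphic_egfQuotient (L : PeriodPair) (κ : ℂ) : Meromorphic (egfQuotient L κ) := by
  have hP : Meromorphic ℘[L] := L.meromorphic_weierstrassP
  have hP' : Meromorphic ℘'[L] := L.meromorphic_derivWeierstrassP
  unfold egfQuotient
  intro z
  have := hP z
  have := hP' z
  fun_prop

theorem meromorphic_egfQuotient_comp (L : PeriodPair) (κ a : ℂ) :
    Meromorphic fun w => egfQuotient L κ (w / κ + a) := fun w =>
  (meromorphic_egfQuotient L κ _).comp_analyticAt (g := fun w => w / κ + a) (by fun_prop)

theorem analyticAt_egfQuotient (hκ : κ ≠ 0) (hz : z ∉ L.lattice) (h0 : ℘[L] z ≠ 0) :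
    AnalyticAt ℂ (egfQuotient L κ) z := by
  have hP : AnalyticAt ℂ ℘[L] z := L.analyticOnNhd_weierstrassP z hz
  have hP' : AnalyticAt ℂ ℘'[L] z := L.analyticOnNhd_derivWeierstrassP z hz
  exact (hP'.neg.sub analyticAt_const).div (analyticAt_const.mul hP)
    (mul_ne_zero (mul_ne_zero two_ne_zero hκ) h0)

theorem egfQuotient_add_of_mem_lattice {l : ℂ} (hl : l ∈ L.lattice) (κ z : ℂ) :
    egfQuotient L κ (z + l) = egfQuotient L κ z := by
  rw [egfQuotient, L.derivWeierstrassP_add_coe z ⟨l, hl⟩, L.weierstrassP_add_coe z ⟨l, hl⟩,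
    egfQuotient]

variable (h2 : L.g₂ = 0) (h3 : L.g₃ = -4) (hκ : κ ^ 2 = -3)

include hκ

theorem ne_zero_of_sq_eq_neg_three : κ ≠ 0 := by
  rintro rfl
  norm_num at hκ

include h2 h3

theorem hasDerivAt_egfQuotient (hz : z ∉ L.lattice) (h0 : ℘[L] z ≠ 0) :
    HasDerivAt (egfQuotient L κ) (-κ * egfQuotient L κ (-z) ^ 2) z := by
  have hκ0 := ne_zero_of_sq_eq_neg_three hκ
  have hsq := L.derivWeierstrassP_sq z hz
  rw [h2, h3] at hsq
  refine (((hasDerivAt_derivWeierstrassP hz).fun_neg.sub_const (2 * κ)).fun_div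
    ((hasDerivAt_weierstrassP hz).const_mul (2 * κ))
    (mul_ne_zero (mul_ne_zero two_ne_zero hκ0) h0)).congr_deriv ?_
  rw [egfQuotient, L.weierstrassP_neg, L.derivWeierstrassP_neg, h2]
  field_simp
  linear_combination 3 * hsq + 4 * hκ

variable (ha : 2 * a ∈ L.lattice) (haL : a ∉ L.lattice) (hPa : ℘[L] a = -1)

include ha haL hPa

theorem hasFPowerSeriesAt_egfQuotient_comp :
    HasFPowerSeriesAt (fun w => egfQuotient L κ (w / κ + a)) pseudoFactorialSeries 0 := by
  have hκ0 := ne_zero_of_sq_eq_neg_three hκ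
  have hP0 : ℘[L] a ≠ 0 := by simp [hPa]
  have hadd : Tendsto (fun w => w / κ + a) (𝓝 0) (𝓝 a) := by
    have hcont : Continuous fun w => w / κ + a := by fun_prop
    exact hcont.tendsto' 0 a (by simp)
  refine hasFPowerSeriesAt_pseudoFactorialSeries ?_ ?_ ?_
  · exact (analyticAt_egfQuotient hκ0 haL hP0).fun_comp_of_eq (by fun_prop) (by simp)
  · have hP' : ℘'[L] a = 0 := by simpa using derivWeierstrassP_half_period ha
    simp only [zero_div, zero_add]
    rw [egfQuotient, hP', hPa]
    field_simp
    norm_num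
  · filter_upwards [hadd.eventually (eventually_notMem_lattice haL), hadd.eventually
      ((L.analyticOnNhd_weierstrassP a haL).continuousAt.eventually_ne hP0)] with w hwL hw0
    have hneg : egfQuotient L κ (-w / κ + a) = egfQuotient L κ (-(w / κ + a)) := by
      rw [← egfQuotient_add_of_mem_lattice ha κ (-(w / κ + a))]
      congr 1
      ring
    have hlin : HasDerivAt (fun w : ℂ => w / κ + a) (1 / κ) w :=
      ((hasDerivAt_id w).div_const κ).add_const a
    have hcomp := HasDerivAt.comp (h := fun w => w / κ + a) (h₂ := egfQuotient L κ) w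
      (hasDerivAt_egfQuotient h2 h3 hκ hwL hw0) hlin
    rw [← Function.comp_def (egfQuotient L κ), hcomp.deriv, hneg]
    field_simp

theorem exists_isPseudoFactorialEGF : ∃ f, IsPseudoFactorialEGF f :=
  exists_isPseudoFactorialEGF_of_hasFPowerSeriesAt (meromorphic_egfQuotient_comp L κ a)
    (hasFPowerSeriesAt_egfQuotient_comp h2 h3 hκ ha haL hPa)

theorem egf_mul_eq_egfQuotient {f : ℂ → ℂ} (hf : IsPseudoFactorialEGF f)
    (hz : z + a ∉ L.lattice) (h0 : ℘[L] (z + a) ≠ 0) : f (κ * z) = egfQuotient L κ (z + a) := by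
  have hκ0 := ne_zero_of_sq_eq_neg_three hκ
  have hzκ : κ * z / κ = z := mul_div_cancel_left₀ z hκ0
  have hNF : AnalyticAt ℂ (fun w => egfQuotient L κ (w / κ + a)) (κ * z) :=
    (analyticAt_egfQuotient hκ0 hz h0).fun_comp_of_eq (by fun_prop) (by rw [hzκ])
  rw [egf_eq_of_hasFPowerSeriesAt hf (meromorphic_egfQuotient_comp L κ a)
    (hasFPowerSeriesAt_egfQuotient_comp h2 h3 hκ ha haL hPa) hNF.meromorphicNFAt, hzκ]

end EllipticQuotient

section HalfPeriod

variable {L : PeriodPair} {T : ℝ} (hT : IsLeastRealPeriod L T)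

include hT

theorem two_mul_half_period_mem_lattice : 2 * ((T / 2 : ℝ) : ℂ) ∈ L.lattice := by
  have hTL := hT.mem_lattice
  push_cast
  rwa [mul_div_cancel₀ _ (two_ne_zero' ℂ)]

theorem half_period_notMem_lattice : ((T / 2 : ℝ) : ℂ) ∉ L.lattice :=
  hT.notMem_lattice ⟨half_pos hT.pos, half_lt_self hT.pos⟩

theorem weierstrassP_half_period (h2 : L.g₂ = 0) (h3 : L.g₃ = -4) :
    ℘[L] ((T / 2 : ℝ) : ℂ) = -1 := by
  rw [← (isRealLattice_of_g₂_eq_zero_g₃_eq h2 h3).ofReal_realP, realP_half_period h2 h3 hT]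
  norm_num

end HalfPeriod

theorem I_mul_sqrt_three_sq : (Complex.I * (Real.sqrt 3 : ℂ)) ^ 2 = -3 := by
  rw [mul_pow, Complex.I_sq, ← Complex.ofReal_pow, Real.sq_sqrt (by norm_num)]
  norm_num

end PseudoFactorial

open PseudoFactorial

theorem theorem2 :
    (∃ L : PeriodPair, L.g₂ = 0 ∧ L.g₃ = -4) ∧
    (∃ f : ℂ → ℂ, IsPseudoFactorialEGF f) ∧
    ∀ (L : PeriodPair) (f : ℂ → ℂ), L.g₂ = 0 → L.g₃ = -4 → IsPseudoFactorialEGF f →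
      ∃ r : ℝ,
        IsLeast {t : ℝ | 0 < t ∧ Function.Periodic L.weierstrassP (t : ℂ)} (6 * r) ∧
        6 * r = piThree * (2 : ℝ) ^ (-(1 / 3) : ℝ) ∧
        6 * r = (2 : ℝ) ^ (-(4 / 3) : ℝ) * (3 : ℝ) ^ (1 / 2 : ℝ) / Real.pi *
          Real.Gamma (1 / 3) ^ 3 ∧
        ∀ z : ℂ, z + 3 * (r : ℂ) ∉ L.lattice → L.weierstrassP (z + 3 * (r : ℂ)) ≠ 0 →
          f (Complex.I * (Real.sqrt 3 : ℂ) * z) =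
            (-L.derivWeierstrassP (z + 3 * (r : ℂ)) - 2 * Complex.I * (Real.sqrt 3 : ℂ)) /
              (2 * Complex.I * (Real.sqrt 3 : ℂ) * L.weierstrassP (z + 3 * (r : ℂ))) := by
  have hex : ∃ L : PeriodPair, L.g₂ = 0 ∧ L.g₃ = -4 :=
    exists_periodPair_g₂_eq_zero_g₃_eq (by norm_num)
  refine ⟨hex, ?_, fun L f h2 h3 hf => ?_⟩
  · obtain ⟨L, h2, h3⟩ := hex
    obtain ⟨T, hT⟩ := (isRealLattice_of_g₂_eq_zero_g₃_eq h2 h3).exists_isLeastRealPeriod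
    exact exists_isPseudoFactorialEGF h2 h3 I_mul_sqrt_three_sq
      (two_mul_half_period_mem_lattice hT) (half_period_notMem_lattice hT)
      (weierstrassP_half_period hT h2 h3)
  · obtain ⟨T, hT⟩ := (isRealLattice_of_g₂_eq_zero_g₃_eq h2 h3).exists_isLeastRealPeriod
    have hTeq := leastRealPeriod_eq_piThree_mul h2 h3 hT
    have h6r : 6 * (T / 6) = T := by ring
    have h3r : 3 * ((T / 6 : ℝ) : ℂ) = ((T / 2 : ℝ) : ℂ) := by push_cast; ring
    refine ⟨T / 6, ?_, ?_, ?_, fun z hz h0 => ?_⟩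
    · simpa only [h6r, periodic_weierstrassP_iff, IsLeastRealPeriod] using hT
    · rw [h6r, hTeq]
    · rw [h6r, hTeq, piThree_mul_two_rpow]
    · rw [h3r] at hz h0 ⊢
      rw [egf_mul_eq_egfQuotient h2 h3 I_mul_sqrt_three_sq (two_mul_half_period_mem_lattice hT)
        (half_period_notMem_lattice hT) (weierstrassP_half_period hT h2 h3) hf hz h0, egfQuotient]
      simp only [mul_assoc]
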